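/- A \emph{generalized partition with $n$ parts} is a sequence $\lambda=(\lambda_1\ge\dots\ge\lambda_n)$ of integers; adding (deleting) a box in row $i$ means adding $1$ to (subtracting $1$ from) $\lambda_i$. A \emph{generalized oscillating tableau} in $\mathrm{GOT}(k,n)$ is a sequence $T=(\lambda^0,\dots,\lambda^k)$ of generalized partitions with $n$ parts with $\lambda^0=(0,\dots,0)$ such that each $\lambda^{s}$ is obtained from $\lambda^{s-1}$ by adding or deleting one box. \emph{Promotion.} For $T\in\mathrm{GOT}(k,n)$, the promotion $p(T)=(\mu^0,\dots,\mu^k)\in\mathrm{GOT}(k,n)$ is the unique tableau with $\mu^0=(0,\dots,0)$, $\mu^k=\lambda^k$ and, for $1\le s<k$: if $\lambda^s$ is obtained from $\mu^{s-1}$ by adding a box in row $i$ and $\lambda^{s+1}$ from $\lambda^s$ by adding or deleting a box in row $j$, then $\mu^s$ is obtained from $\mu^{s-1}$ by that same second action whenever the result is a generalized partition; otherwise, if the second action is an addition (then $j\ne i$), $\mu^s$ is $\mu^{s-1}$ with a box added in row $i$, and if it is a deletion (then $j=i$), $\mu^s$ is $\mu^{s-1}$ with a box deleted in row $i+t$,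 where $t>0$ is the least value for which this is a generalized partition. If $\lambda^s$ is obtained from $\mu^{s-1}$ by deleting a box in row $i$, the rules are the same with adding and deleting exchanged and $i-t$ in place of $i+t$. \emph{Webs.} A \emph{web} (irreducible $A_2$-web) is a planar bipartite graph without multiple edges, with vertices coloured black ($\bullet$) and white ($\circ$), embedded in a disk, whose boundary vertices have degree $1$, whose internal vertices have degree $3$, and all of whose internal faces have at least $6$ sides, considered up to homeomorphism. It \emph{contains the identity web} if some edge joins two boundary vertices. Let $D$ be a web with boundary vertices $v_1,\dots,v_k$ in clockwise order from a chosen leftmost vertex $v_1$. Its \emph{signature and state string} is the dominant string $((j_1,c_1),\dots,(j_k,c_k))$, $j_s\in\{1,0,\bar1\}$, $c_s\in\{\bullet,\circ\}$ the colour of $v_s$, from which the Khovanov--Kuperberg growth rules build $D$: hang from $v_1,\dots,v_k$, placed on a line, strands labelled $j_1,\dots,j_k$, and repeatedly replace two neighbouring strands (the colour of a strand is that of its upper end) until none is left, by \begin{itemize} \item joining them at a new vertex of the opposite colour with one new strand: $1_\bullet0_\bullet\to\bar1_\circ$, $0_\bullet\bar1_\bullet\to1_\circ$, $1_\bullet\bar1_\bullet\to0_\circ$,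 $\bar1_\circ0_\circ\to1_\bullet$, $0_\circ1_\circ\to\bar1_\bullet$, $\bar1_\circ1_\circ\to0_\bullet$; \item ending them at two new vertices joined by an edge, each with one new strand: $1_\bullet0_\circ\to0_\circ1_\bullet$, $0_\bullet0_\circ\to1_\circ1_\bullet$, $0_\bullet1_\circ\to1_\circ0_\bullet$, $\bar1_\circ0_\bullet\to0_\bullet\bar1_\circ$, $0_\circ0_\bullet\to\bar1_\bullet\bar1_\circ$, $0_\circ\bar1_\bullet\to\bar1_\bullet0_\circ$; \item joining them to one edge: $1_\bullet1_\circ$ or $\bar1_\circ\bar1_\bullet$. \end{itemize} Here a string is \emph{dominant} if the path of partial sums of its weights, where $(1,\bullet),(0,\bullet),(\bar1,\bullet)$ have the three weights of the vector representation of $\mathfrak{sl}(3)$ and $(j,\circ)$ has the negative of the weight of $(j,\bullet)$, stays in the dominant chamber (the non-negative integral combinations of the weights of $(1,\bullet)$ and $(\bar1,\circ)$) and ends at the origin. The tableau $T=(\lambda^0,\dots,\lambda^k)\in\mathrm{GOT}(k,3)$ that \emph{comes from} $D$ has $\lambda^s$ obtained from $\lambda^{s-1}$ by adding (if $c_s=\bullet$)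 or deleting (if $c_s=\circ$) a box in row $1$, $2$, $3$ according as $j_s=1,0,\bar1$. \textbf{Proposition.} Let $T=(\lambda^0,\dots,\lambda^k)$ come from a web that does not contain the identity web, and let $p(T)=(\mu^0,\dots,\mu^k)$. \begin{enumerate} \item If $\lambda^1=(1,0,0)$, then for every $s\in[1,k]$ the shape $\lambda^s$ is obtained from $\mu^{s-1}$ by adding a box in some row $i_s$, and there are $m,n\in[1,k]$ with $m+1<n$ such that $i_s=1$ for $s\le m$, $i_s=2$ for $m<s<n$, and $i_s=3$ for $s\ge n$. \item If $\lambda^1=(0,0,-1)$, then for every $s\in[1,k]$ the shape $\lambda^s$ is obtained from $\mu^{s-1}$ by deleting a box in some row $i_s$, and there are $m,n\in[1,k]$ with $m+1<n$ such that $i_s=3$ for $s\le m$, $i_s=2$ for $m<s<n$, and $i_s=1$ for $s\ge n$. \end{enumerate} -/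

import Mathlib

/-! ### Generalized oscillating tableaux -/

/-- Add one box in row `i` of a sequence of `n` integer row sizes. -/
def addBox {n : ℕ} (a : Fin n → ℤ) (i : Fin n) : Fin n → ℤ := a + Pi.single i 1

/-- Delete one box in row `i` of a sequence of `n` integer row sizes. -/
def delBox {n : ℕ} (a : Fin n → ℤ) (i : Fin n) : Fin n → ℤ := a - Pi.single i 1

/-- `b` is obtained from `a` by adding or deleting one box. -/
def OneBox {n : ℕ} (a b : Fin n → ℤ) : Prop := ∃ i, b = addBox a i ∨ b = delBox a i

/-- Generalized oscillating tableaux of length `k` with `n` parts: a generalized partition with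
`n` parts is an antitone function `Fin n → ℤ` (row `i` of the usual numbering is `i - 1`). -/
@[ext]
structure GOT (k n : ℕ) where
  shape : Fin (k + 1) → Fin n → ℤ
  isGenPartition : ∀ s, Antitone (shape s)
  shape_zero : shape 0 = 0
  oneBox : ∀ s : Fin k, OneBox (shape s.castSucc) (shape s.succ)

/-! ### Generalized oscillating promotion -/

/-- The local growth rules: `GrowthRule mu lam lam' nu` says that `nu` (playing `μ^s`) is the shape
that the rules produce from `mu` (`μ^{s-1}`), `lam` (`λ^s`) and `lam'` (`λ^{s+1}`). -/
inductive GrowthRule {n : ℕ} (mu lam lam' : Fin n → ℤ) : (Fin n → ℤ) → Prop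
  | op1a (i j : Fin n) (h1 : lam = addBox mu i) (h2 : lam' = addBox lam j)
      (h : Antitone (addBox mu j)) : GrowthRule mu lam lam' (addBox mu j)
  | op1b (i j : Fin n) (h1 : lam = addBox mu i) (h2 : lam' = addBox lam j) (hij : j ≠ i)
      (h : ¬ Antitone (addBox mu j)) : GrowthRule mu lam lam' (addBox mu i)
  | op1c (i j : Fin n) (h1 : lam = addBox mu i) (h2 : lam' = delBox lam j)
      (h : Antitone (delBox mu j)) : GrowthRule mu lam lam' (delBox mu j)
  | op1d (i r : Fin n) (h1 : lam = addBox mu i) (h2 : lam' = delBox lam i)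
      (h : ¬ Antitone (delBox mu i)) (hr : i < r) (hr' : Antitone (delBox mu r))
      (hmin : ∀ q, i < q → q < r → ¬ Antitone (delBox mu q)) :
      GrowthRule mu lam lam' (delBox mu r)
  | op2a (i j : Fin n) (h1 : lam = delBox mu i) (h2 : lam' = delBox lam j)
      (h : Antitone (delBox mu j)) : GrowthRule mu lam lam' (delBox mu j)
  | op2b (i j : Fin n) (h1 : lam = delBox mu i) (h2 : lam' = delBox lam j) (hij : j ≠ i)
      (h : ¬ Antitone (delBox mu j)) : GrowthRule mu lam lam' (delBox mu i)
  | op2c (i j : Fin n) (h1 : lam = delBox mu i) (h2 : lam' = addBox lam j)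
      (h : Antitone (addBox mu j)) : GrowthRule mu lam lam' (addBox mu j)
  | op2d (i r : Fin n) (h1 : lam = delBox mu i) (h2 : lam' = addBox lam i)
      (h : ¬ Antitone (addBox mu i)) (hr : r < i) (hr' : Antitone (addBox mu r))
      (hmin : ∀ q, r < q → q < i → ¬ Antitone (addBox mu q)) :
      GrowthRule mu lam lam' (addBox mu r)

/-- `P = (μ^0, …, μ^k)` is produced from `T = (λ^0, …, λ^k)` by the promotion growth rules. -/
structure IsPromotion {k n : ℕ} (T P : GOT k n) : Prop where
  rule : ∀ (s : ℕ) (hs : s + 2 ≤ k),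
    GrowthRule (P.shape ⟨s, by omega⟩) (T.shape ⟨s + 1, by omega⟩)
      (T.shape ⟨s + 2, by omega⟩) (P.shape ⟨s + 1, by omega⟩)
  last : P.shape (Fin.last k) = T.shape (Fin.last k)

theorem addBox_eq_iff {n : ℕ} {a : Fin n → ℤ} {i j : Fin n} : addBox a i = addBox a j ↔ i = j := by
  constructor
  · intro h
    by_contra hij
    have := congrFun h i
    simp [addBox, hij] at this
  · rintro rfl; rfl

theorem delBox_eq_iff {n : ℕ} {a : Fin n → ℤ} {i j : Fin n} : delBox a i = delBox a j ↔ i = j := by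
  constructor
  · intro h
    by_contra hij
    have := congrFun h i
    simp [delBox, hij] at this
  · rintro rfl; rfl

theorem addBox_ne_delBox {n : ℕ} (a : Fin n → ℤ) (i j : Fin n) : addBox a i ≠ delBox a j := by
  intro h
  have := congrFun h i
  simp only [addBox, delBox, Pi.add_apply, Pi.sub_apply, Pi.single_apply] at this
  split_ifs at this <;> omega

theorem antitone_addBox_iff {n : ℕ} {a : Fin n → ℤ} (ha : Antitone a) (j : Fin n) :
    Antitone (addBox a j) ↔ ∀ r < j, a j < a r := by
  constructor
  · intro h r hr
    have := h hr.le
    simp only [addBox, Pi.add_apply, Pi.single_apply, if_neg hr.ne] at this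
    simp at this
    omega
  · intro h x y hxy
    have h0 := ha hxy
    simp only [addBox, Pi.add_apply, Pi.single_apply]
    split_ifs with h1 h2 h2
    · omega
    · subst h1
      have := h x (lt_of_le_of_ne hxy h2)
      omega
    · omega
    · omega

theorem antitone_delBox_iff {n : ℕ} {a : Fin n → ℤ} (ha : Antitone a) (j : Fin n) :
    Antitone (delBox a j) ↔ ∀ r, j < r → a r < a j := by
  constructor
  · intro h r hr
    have := h hr.le
    simp only [delBox, Pi.sub_apply, Pi.single_apply, if_neg hr.ne'] at this
    simp at this
    omega
  · intro h x y hxy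
    have h0 := ha hxy
    simp only [delBox, Pi.sub_apply, Pi.single_apply]
    split_ifs with h1 h2 h2
    · omega
    · omega
    · subst h2
      have := h y (lt_of_le_of_ne hxy fun e => h1 e.symm)
      omega
    · omega

theorem addBox_delBox {n : ℕ} (a : Fin n → ℤ) (i j : Fin n) :
    addBox (delBox a i) j = delBox (addBox a j) i := by
  simp only [addBox, delBox]; abel

theorem addBox_addBox {n : ℕ} (a : Fin n → ℤ) (i j : Fin n) :
    addBox (addBox a i) j = addBox (addBox a j) i := by
  simp only [addBox]; abel

theorem delBox_delBox {n : ℕ} (a : Fin n → ℤ) (i j : Fin n) :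
    delBox (delBox a i) j = delBox (delBox a j) i := by
  simp only [delBox]; abel

theorem delBox_addBox_self {n : ℕ} (a : Fin n → ℤ) (i : Fin n) :
    delBox (addBox a i) i = a := by
  simp [addBox, delBox]

theorem GrowthRule.unique {n : ℕ} {mu lam lam' x y : Fin n → ℤ}
    (hx : GrowthRule mu lam lam' x) (hy : GrowthRule mu lam lam' y) : x = y := by
  cases hx <;> cases hy <;>
    grind [addBox_eq_iff, delBox_eq_iff, addBox_ne_delBox]

theorem GrowthRule.exists {n : ℕ} {mu lam lam' : Fin n → ℤ}
    (hmu : Antitone mu) (hlam : Antitone lam) (hlam' : Antitone lam')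
    (h1 : OneBox mu lam) (h2 : OneBox lam lam') :
    ∃ nu, GrowthRule mu lam lam' nu ∧ Antitone nu ∧ OneBox mu nu ∧ OneBox nu lam' := by
  obtain ⟨i, hi | hi⟩ := h1 <;> obtain ⟨j, hj | hj⟩ := h2
  · by_cases h : Antitone (addBox mu j)
    · exact ⟨_, .op1a i j hi hj h, h, ⟨j, .inl rfl⟩, i, .inl (by rw [hj, hi, addBox_addBox])⟩
    · refine ⟨_, .op1b i j hi hj ?_ h, hi ▸ hlam, ⟨i, .inl rfl⟩, j, .inl (by rw [hj, hi])⟩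
      rintro rfl
      exact h (hi ▸ hlam)
  · by_cases h : Antitone (delBox mu j)
    · exact ⟨_, .op1c i j hi hj h, h, ⟨j, .inr rfl⟩, i, .inl (by rw [hj, hi, addBox_delBox])⟩
    · have hji : j = i := by
        by_contra hji
        apply h
        rw [antitone_delBox_iff hmu]
        intro r hr
        have := hlam' hr.le
        rw [hj, hi] at this
        simp only [addBox, delBox, Pi.add_apply, Pi.sub_apply, Pi.single_apply, if_neg hr.ne',
          if_neg hji, if_true] at this
        split_ifs at this <;> omega
      subst hji
      have hne : {r : Fin n | j < r ∧ Antitone (delBox mu r)}.Nonempty := by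
        rw [antitone_delBox_iff hmu] at h
        push Not at h
        obtain ⟨r, hr, -⟩ := h
        refine ⟨⟨n - 1, by omega⟩, ?_, ?_⟩
        · rw [Fin.lt_def] at hr ⊢
          simp only
          omega
        · rw [antitone_delBox_iff hmu]
          intro q hq
          rw [Fin.lt_def] at hq
          simp only at hq
          omega
      obtain ⟨r, ⟨hr, hr'⟩, hmin⟩ := wellFounded_lt.has_min _ hne
      exact ⟨_, .op1d j r hi hj h hr hr' fun q hq hqr hq' => hmin q ⟨hq, hq'⟩ hqr, hr',
        ⟨r, .inr rfl⟩, r, .inl (by rw [hj, hi, delBox_addBox_self, addBox_delBox,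
          delBox_addBox_self])⟩
  · by_cases h : Antitone (addBox mu j)
    · exact ⟨_, .op2c i j hi hj h, h, ⟨j, .inl rfl⟩, i, .inr (by rw [hj, hi, addBox_delBox])⟩
    · have hji : j = i := by
        by_contra hji
        apply h
        rw [antitone_addBox_iff hmu]
        intro r hr
        have := hlam' hr.le
        rw [hj, hi] at this
        simp only [addBox, delBox, Pi.add_apply, Pi.sub_apply, Pi.single_apply, if_neg hr.ne,
          if_neg hji, if_true] at this
        split_ifs at this <;> omega
      subst hji
      have hne : {r : Fin n | r < j ∧ Antitone (addBox mu r)}.Nonempty := by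
        rw [antitone_addBox_iff hmu] at h
        push Not at h
        obtain ⟨r, hr, -⟩ := h
        refine ⟨⟨0, by omega⟩, ?_, ?_⟩
        · rw [Fin.lt_def] at hr ⊢
          simp only
          omega
        · rw [antitone_addBox_iff hmu]
          intro q hq
          rw [Fin.lt_def] at hq
          simp only at hq
          omega
      obtain ⟨r, ⟨hr, hr'⟩, hmin⟩ := wellFounded_gt.has_min _ hne
      exact ⟨_, .op2d j r hi hj h hr hr' fun q hq hqr hq' => hmin q ⟨hqr, hq'⟩ hq, hr',
        ⟨r, .inl rfl⟩, r, .inr (by rw [hj, hi, addBox_delBox, delBox_addBox_self,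
          delBox_addBox_self])⟩
  · by_cases h : Antitone (delBox mu j)
    · exact ⟨_, .op2a i j hi hj h, h, ⟨j, .inr rfl⟩, i, .inr (by rw [hj, hi, delBox_delBox])⟩
    · refine ⟨_, .op2b i j hi hj ?_ h, hi ▸ hlam, ⟨i, .inr rfl⟩, j, .inr (by rw [hj, hi])⟩
      rintro rfl
      exact h (hi ▸ hlam)

open Classical in
theorem GOT.exists_isPromotion {k n : ℕ} (T : GOT k n) : ∃ P : GOT k n, IsPromotion T P := by
  let L : ℕ → Fin n → ℤ := fun s => if h : s ≤ k then T.shape ⟨s, by omega⟩ else 0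
  have hL : ∀ s (h : s ≤ k), L s = T.shape ⟨s, by omega⟩ := fun s h => dif_pos h
  have hLstep : ∀ s, s < k → OneBox (L s) (L (s + 1)) := by
    intro s h
    rw [hL s h.le, hL (s + 1) h]
    exact T.oneBox ⟨s, h⟩
  have hLanti : ∀ s, s ≤ k → Antitone (L s) := fun s h => hL s h ▸ T.isGenPartition _
  have hL0 : L 0 = 0 := (hL 0 (by omega)).trans T.shape_zero
  let Q : ℕ → (Fin n → ℤ) → (Fin n → ℤ) → Prop := fun s x nu =>
    GrowthRule x (L (s + 1)) (L (s + 2)) nu ∧ Antitone nu ∧ OneBox x nu ∧ OneBox nu (L (s + 2))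
  let step : ℕ → (Fin n → ℤ) → Fin n → ℤ := fun s x => if h : ∃ nu, Q s x nu then h.choose else x
  let M : ℕ → Fin n → ℤ := fun s => Nat.rec 0 step s
  have hMQ : ∀ s, (∃ nu, Q s (M s) nu) → Q s (M s) (M (s + 1)) := by
    intro s h
    have : M (s + 1) = h.choose := dif_pos h
    rw [this]
    exact h.choose_spec
  have hM : ∀ s, s < k → Antitone (M s) ∧ OneBox (M s) (L (s + 1)) := by
    intro s
    induction s with
    | zero =>
      intro h
      refine ⟨fun _ _ _ => le_rfl, ?_⟩
      have := hLstep 0 h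
      rwa [hL0] at this
    | succ s ih =>
      intro h
      obtain ⟨h1, h2⟩ := ih (by omega)
      have := hMQ s (GrowthRule.exists h1 (hLanti _ (by omega)) (hLanti _ (by omega)) h2
        (hLstep (s + 1) h))
      exact ⟨this.2.1, this.2.2.2⟩
  have hMrule : ∀ s, s + 1 < k → Q s (M s) (M (s + 1)) := fun s h =>
    hMQ s (GrowthRule.exists (hM s (by omega)).1 (hLanti _ (by omega)) (hLanti _ (by omega))
      (hM s (by omega)).2 (hLstep (s + 1) h))
  let R : ℕ → Fin n → ℤ := fun s => if s < k then M s else L k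
  have hR1 : ∀ s, s < k → R s = M s := fun s h => if_pos h
  have hR2 : R k = L k := if_neg (lt_irrefl k)
  refine ⟨⟨fun s => R s, ?_, ?_, ?_⟩, ?_, ?_⟩
  · intro s
    show Antitone (R s)
    by_cases h : (s : ℕ) < k
    · rw [hR1 _ h]; exact (hM _ h).1
    · rw [show (s : ℕ) = k by omega, hR2]; exact hLanti k le_rfl
  · show R 0 = 0
    by_cases h : 0 < k
    · exact hR1 _ h
    · rw [show 0 = k by omega, hR2, ← show 0 = k by omega, hL0]
  · intro s
    show OneBox (R s) (R (s + 1))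
    rw [hR1 _ s.2]
    by_cases h : (s : ℕ) + 1 < k
    · rw [hR1 _ h]; exact (hMrule _ h).2.2.1
    · have hs : (s : ℕ) + 1 = k := by omega
      have := (hM _ s.2).2
      rw [hs] at this ⊢
      rwa [hR2]
  · intro s hs
    show GrowthRule (R s) _ _ (R (s + 1))
    by_cases h : s + 1 < k
    · rw [hR1 _ h, hR1 _ (by omega), ← hL, ← hL]
      · exact (hMrule _ h).1
      · omega
      · omega
    · omega
  · show R k = _
    rw [hR2, hL k le_rfl]
    rfl

theorem GOT.existsUnique_isPromotion {k n : ℕ} (T : GOT k n) : ∃! P : GOT k n, IsPromotion T P := by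
  obtain ⟨P, hP⟩ := T.exists_isPromotion
  refine ⟨P, hP, fun P' hP' => ?_⟩
  have key : ∀ s (h : s < k), P'.shape ⟨s, by omega⟩ = P.shape ⟨s, by omega⟩ := by
    intro s
    induction s with
    | zero => intro h; exact P'.shape_zero.trans P.shape_zero.symm
    | succ s ih =>
      intro h
      have h1 := hP'.rule s (by omega)
      rw [ih (by omega)] at h1
      exact h1.unique (hP.rule s (by omega))
  apply GOT.ext
  funext s
  by_cases h : (s : ℕ) < k
  · exact key s h
  · have : s = Fin.last k := Fin.ext (by simp; omega)
    rw [this, hP'.last, hP.last]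

/-- Generalized oscillating promotion `p : GOT(k, n) → GOT(k, n)`. -/
noncomputable def GOT.promotion {k n : ℕ} (T : GOT k n) : GOT k n :=
  T.existsUnique_isPromotion.choose

/-! ### Webs -/

/-- Colours of vertices. -/
inductive Color
  | black
  | white

/-- The states `1`, `0` and `-1`. -/
inductive State
  | one
  | zero
  | negOne

/-- Half-edges of a graph in a disk whose boundary vertices `0, …, k - 1` have degree one and whose
internal vertices `v : V` have degree three. The half-edges at `v` are `(v, 0), (v, 1), (v, 2)` in
clockwise cyclic order. -/
abbrev Dart (k : ℕ) (V : Type*) := Fin k ⊕ V × Fin 3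

/-- The vertex of a half-edge. -/
def Dart.vertex {k : ℕ} {V : Type*} : Dart k V → Fin k ⊕ V
  | Sum.inl i => Sum.inl i
  | Sum.inr x => Sum.inr x.1

/-- The clockwise successor of a half-edge. The exterior of the disk is regarded as one
vertex of the sphere that carries the `k` boundary half-edges; the clockwise order of the boundary
vertices seen from inside the disk is counterclockwise seen from outside. -/
def Dart.next (k : ℕ) (V : Type*) : Equiv.Perm (Dart k V) :=
  Equiv.sumCongr (finRotate k).symm (Equiv.prodCongr (Equiv.refl V) (Equiv.addRight 1))

/-- The number of cycles of a permutation, fixed points included. -/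
noncomputable def numCycles {X : Type*} (p : Equiv.Perm X) : ℕ :=
  Nat.card (Quotient (Equiv.Perm.SameCycle.setoid p))

/-- Irreducible (non-elliptic) `A_2`-webs in a disk with `k` boundary vertices, given as
combinatorial maps. The boundary vertices are numbered clockwise from the chosen leftmost vertex
`0`, and `V` is the set of internal vertices. -/
structure Web (k : ℕ) (V : Type*) [Finite V] where
  color : Fin k ⊕ V → Color
  /-- exchanges the two halves of each edge -/
  edge : Equiv.Perm (Dart k V)
  edge_edge : ∀ d, edge (edge d) = d
  bipartite : ∀ d, color (edge d).vertex ≠ color d.vertex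
  no_multiple_edges : ∀ d d', d.vertex = d'.vertex → (edge d).vertex = (edge d').vertex → d = d'
  /-- Euler's formula `V - E + F = 2 C`: the map has genus zero. -/
  planar : numCycles (Dart.next k V) + numCycles (Dart.next k V * edge) =
    numCycles edge +
      2 * Nat.card (MulAction.orbitRel.Quotient (Subgroup.closure {Dart.next k V, edge}) (Dart k V))
  /-- Faces are the cycles of `next ∘ edge`; those that do not meet the boundary of the disk have
  at least six sides. -/
  nonelliptic : ∀ d, (∀ i, ¬ (Dart.next k V * edge).SameCycle d (Sum.inl i)) →
    6 ≤ Nat.card {d' // (Dart.next k V * edge).SameCycle d d'}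

/-- `D` contains the identity web (an edge joining two boundary vertices) as a component. -/
def Web.ContainsIdentity {k : ℕ} {V : Type*} [Finite V] (D : Web k V) : Prop :=
  ∃ i j : Fin k, D.edge (Sum.inl i) = Sum.inl j

/-! ### Signature and state strings and the web growth rules -/

/-- The Y-shaped growth rules: two neighbouring strands of the given colour with the first two
states are joined to a strand of the other colour with the third state. -/
inductive YRule : Color → State → State → State → Prop
  | b1 : YRule .black .one .zero .negOne
  | b2 : YRule .black .zero .negOne .one
  | b3 : YRule .black .one .negOne .zero
  | w1 : YRule .white .negOne .zero .one
  | w2 : YRule .white .zero .one .negOne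
  | w3 : YRule .white .negOne .one .zero

/-- The H-shaped growth rules: a strand of the given colour and its right neighbour, of the other
colour, with the first two states, are replaced by two strands with the last two states. -/
inductive HRule : Color → State → State → State → State → Prop
  | b1 : HRule .black .one .zero .zero .one
  | b2 : HRule .black .zero .zero .one .one
  | b3 : HRule .black .zero .one .one .zero
  | w1 : HRule .white .negOne .zero .zero .negOne
  | w2 : HRule .white .zero .zero .negOne .negOne
  | w3 : HRule .white .zero .negOne .negOne .zero

/-- The arc growth rules: a strand of the given colour and its right neighbour, of the other
colour, both with the given state, are joined. -/
inductive ArcRule : Color → State → Prop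
  | b : ArcRule .black .one
  | w : ArcRule .white .negOne

/-- `D.Grows l U`: starting from the strands `l` (from left to right; a strand is
an edge hanging down from the vertex of its half-edge, labelled by a state), the
growth rules can be applied until no strand is left, and what they draw is the part of `D` below
the strands, whose set of internal vertices is `U`. -/
inductive Web.Grows {k : ℕ} {V : Type*} [Finite V] (D : Web k V) :
    List (Dart k V × State) → Set V → Prop
  | done : Web.Grows D [] ∅
  /-- The new vertex `v` has the half-edges `(v, a)` up left, `(v, a + 1)` up right and
  `(v, a + 2)` down. -/
  | fork (l r : List (Dart k V × State)) (U : Set V) (d₁ d₂ : Dart k V) (s₁ s₂ t : State)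
      (v : V) (a : Fin 3)
      (hc : D.color d₂.vertex = D.color d₁.vertex)
      (hrule : YRule (D.color d₁.vertex) s₁ s₂ t)
      (h₁ : D.edge d₁ = Sum.inr (v, a)) (h₂ : D.edge d₂ = Sum.inr (v, a + 1))
      (hv : v ∉ U)
      (h : Web.Grows D (l ++ (Sum.inr (v, a + 2), t) :: r) U) :
      Web.Grows D (l ++ (d₁, s₁) :: (d₂, s₂) :: r) (insert v U)
  /-- The new left vertex `v` has the half-edges `(v, a)` up left, `(v, a + 1)` right and
  `(v, a + 2)` down left; the new right vertex `w` has the half-edges `(w, b)` up right,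
  `(w, b + 1)` down right and `(w, b + 2)` left. -/
  | cross (l r : List (Dart k V × State)) (U : Set V) (d₁ d₂ : Dart k V) (s₁ s₂ t₁ t₂ : State)
      (v w : V) (a b : Fin 3)
      (hc : D.color d₂.vertex ≠ D.color d₁.vertex)
      (hrule : HRule (D.color d₁.vertex) s₁ s₂ t₁ t₂)
      (h₁ : D.edge d₁ = Sum.inr (v, a)) (h₂ : D.edge d₂ = Sum.inr (w, b))
      (hmid : D.edge (Sum.inr (v, a + 1)) = Sum.inr (w, b + 2))
      (hvw : v ≠ w) (hv : v ∉ U) (hw : w ∉ U)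
      (h : Web.Grows D (l ++ (Sum.inr (v, a + 2), t₁) :: (Sum.inr (w, b + 1), t₂) :: r) U) :
      Web.Grows D (l ++ (d₁, s₁) :: (d₂, s₂) :: r) (insert v (insert w U))
  | arc (l r : List (Dart k V × State)) (U : Set V) (d₁ d₂ : Dart k V) (s : State)
      (hc : D.color d₂.vertex ≠ D.color d₁.vertex)
      (hrule : ArcRule (D.color d₁.vertex) s)
      (h₁ : D.edge d₁ = d₂)
      (h : Web.Grows D (l ++ r) U) :
      Web.Grows D (l ++ (d₁, s) :: (d₂, s) :: r) U

/-- The `sl(3)`-weight of a state with a black vertex, in the basis of the weight lattice formed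
by the weights of `(1, •)` and `(-1, ∘)`. -/
def State.weight : State → ℤ × ℤ
  | .one => (1, 0)
  | .zero => (-1, 1)
  | .negOne => (0, -1)

/-- The weight of a state and colour. -/
def letterWeight : State → Color → ℤ × ℤ
  | s, .black => s.weight
  | s, .white => -s.weight

/-- The signature and state string with states `s` and colours `c` is dominant: its weight path
starts and ends at the origin and stays in the dominant chamber. -/
def IsDominant {k : ℕ} (s : Fin k → State) (c : Fin k → Color) : Prop :=
  ∃ path : Fin (k + 1) → ℤ × ℤ, path 0 = 0 ∧ path (Fin.last k) = 0 ∧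
    (∀ i : Fin k, path i.succ = path i.castSucc + letterWeight (s i) (c i)) ∧ ∀ i, 0 ≤ path i

/-- The row on which a state acts. -/
def State.row : State → Fin 3
  | .one => 0
  | .zero => 1
  | .negOne => 2

/-- The action of a letter of a signature and state string on a generalized partition. -/
def letterAct : State → Color → (Fin 3 → ℤ) → Fin 3 → ℤ
  | s, .black, a => addBox a s.row
  | s, .white, a => delBox a s.row

/-- `s` is the state string of the web `D`: with the colours of the boundary vertices of `D` it is
a dominant signature and state string, from which the growth rules build `D`. -/
def Web.HasStates {k : ℕ} {V : Type*} [Finite V] (D : Web k V) (s : Fin k → State) : Prop :=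
  IsDominant s (fun i => D.color (Sum.inl i)) ∧
    D.Grows (List.ofFn fun i => (Sum.inl i, s i)) Set.univ

/-- `T` is the generalized oscillating tableau that comes from the web `D`. -/
def GOT.ComesFrom {k : ℕ} {V : Type*} [Finite V] (T : GOT k 3) (D : Web k V) : Prop :=
  ∃ s : Fin k → State, D.HasStates s ∧
    ∀ i : Fin k, T.shape i.succ = letterAct (s i) (D.color (Sum.inl i)) (T.shape i.castSucc)

/-! ### Rows of the promotion of a tableau with three rows -/

/-! Write `λ^s` as `μ^{s-1}` with a box added in row `i_s`. A local rule never decreases `i_s`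
(`GrowthRule.addBox_row`). The sequence starts in the top row, and it ends in the bottom row because
the weight path closes, so that `λ^k` has three equal rows. The only way to miss row 2 is a direct
jump from row 1 to row 3, and the rules allow it only when `μ^{s-1}` has three equal rows and
`λ^{s+1} = μ^{s-1}`.

Such a jump forces an identity web. Up to it every `λ^r` is `μ^{r-1}` plus a box in row 1, so
relative to `λ^1` the weight path of `λ` follows the dominant path of `μ`. It is back at `λ^1` just
before the jump and at the origin just after it. The string therefore reads `x u y v` with `x =
(1,•)`, `y = (1,∘)` and `u`, `v` closed dominant words.

The web growth rules preserve this form: `u` and `v` begin with a dominant letter and end with an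
antidominant one, and no rule has an antidominant left strand or a dominant right strand. Each rule
thus acts inside `u`, inside `v`, or on the pair `x y` itself, and only an arc can join that pair
(`Web.Grows.edge_eq`). So `x` and `y` are the ends of one edge, contrary to the hypothesis. The
second case follows from the first by negating and reversing shapes (`GrowthRule.flipShape`). -/

theorem GrowthRule.addBox_row {mu lam lam' nu : Fin 3 → ℤ} {i : Fin 3}
    (h : GrowthRule mu lam lam' nu) (hmu : Antitone mu) (hlam' : Antitone lam')
    (hi : lam = addBox mu i) :
    ∃ j, lam' = addBox nu j ∧ i ≤ j ∧
      (i = 0 → j = 2 → lam' = mu ∧ mu 0 = mu 1 ∧ mu 1 = mu 2) := by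
  cases h with
  | op1a i' j h1 h2 h =>
    obtain rfl : i' = i := addBox_eq_iff.1 (h1.symm.trans hi)
    refine ⟨i', by rw [h2, h1, addBox_addBox], le_rfl, ?_⟩
    rintro rfl h
    simp at h
  | op1b i' j h1 h2 hij h =>
    obtain rfl : i' = i := addBox_eq_iff.1 (h1.symm.trans hi)
    subst h1 h2
    refine ⟨j, rfl, ?_⟩
    -- A box in row `j` alone is illegal but becomes legal after the box in row `i'`, so `mu` has
    -- equal entries in rows `i' < j`. If these were rows `0` and `2`, all three entries would agree
    -- and `lam'` would not be a generalized partition.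
    have e1 := hmu (show (0 : Fin 3) ≤ 1 by decide)
    have e2 := hmu (show (1 : Fin 3) ≤ 2 by decide)
    have f1 := hlam' (show (0 : Fin 3) ≤ 1 by decide)
    have f2 := hlam' (show (1 : Fin 3) ≤ 2 by decide)
    rw [antitone_addBox_iff hmu, Fin.forall_fin_succ, Fin.forall_fin_succ, Fin.forall_fin_succ] at h
    fin_cases i' <;> fin_cases j <;> simp_all [addBox] <;> omega
  | op1c i' j h1 h2 h =>
    obtain rfl : i' = i := addBox_eq_iff.1 (h1.symm.trans hi)
    refine ⟨i', by rw [h2, h1, addBox_delBox], le_rfl, ?_⟩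
    rintro rfl h
    simp at h
  | op1d i' r h1 h2 h hr hr' hmin =>
    obtain rfl : i' = i := addBox_eq_iff.1 (h1.symm.trans hi)
    rw [h1, delBox_addBox_self] at h2
    refine ⟨r, by rw [h2, addBox_delBox, delBox_addBox_self], hr.le, ?_⟩
    rintro rfl rfl
    refine ⟨h2, ?_⟩
    -- Deletion is blocked in row `0` by the rule and in row `1` by minimality of `r = 2`; this
    -- makes the three entries equal.
    have e1 := hmu (show (0 : Fin 3) ≤ 1 by decide)
    have e2 := hmu (show (1 : Fin 3) ≤ 2 by decide)
    have h' := hmin 1 (by decide) (by decide)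
    rw [antitone_delBox_iff hmu] at h h'
    simp [Fin.forall_fin_succ] at h h'
    omega
  | op2a i' j h1 => exact absurd (hi.symm.trans h1) (addBox_ne_delBox _ _ _)
  | op2b i' j h1 => exact absurd (hi.symm.trans h1) (addBox_ne_delBox _ _ _)
  | op2c i' j h1 => exact absurd (hi.symm.trans h1) (addBox_ne_delBox _ _ _)
  | op2d i' r h1 => exact absurd (hi.symm.trans h1) (addBox_ne_delBox _ _ _)

/-- If the growth rules never produce a jump from row `0` to row `2`, the row in which `lam (s + 1)`
and `mu s` differ passes through `0`, `1`, `2` in this order. -/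
theorem exists_rows_of_growthRule {k : ℕ} (hk : 1 ≤ k) {lam mu : ℕ → Fin 3 → ℤ}
    (hlam : ∀ s, Antitone (lam s)) (hmu : ∀ s, Antitone (mu s))
    (hrule : ∀ s, s + 2 ≤ k → GrowthRule (mu s) (lam (s + 1)) (lam (s + 2)) (mu (s + 1)))
    (hfirst : lam 1 = addBox (mu 0) 0) (hlast : lam k 0 = lam k 2)
    (hjump : ∀ s, s + 2 ≤ k → (∀ r ≤ s, lam (r + 1) = addBox (mu r) 0) →
      mu s 0 = mu s 1 → mu s 1 = mu s 2 → lam (s + 2) ≠ mu s) :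
    ∃ m n : ℕ, 1 ≤ m ∧ m + 1 < n ∧ n ≤ k ∧ ∀ s < k,
      (s + 1 ≤ m → lam (s + 1) = addBox (mu s) 0) ∧
      (m < s + 1 → s + 1 < n → lam (s + 1) = addBox (mu s) 1) ∧
      (n ≤ s + 1 → lam (s + 1) = addBox (mu s) 2) := by
  have hex : ∀ s, ∃ i, s < k → lam (s + 1) = addBox (mu s) i := by
    intro s
    induction s with
    | zero => exact ⟨0, fun _ => hfirst⟩
    | succ s ih =>
      obtain ⟨i, hi⟩ := ih
      by_cases hs : s + 1 < k
      · obtain ⟨j, hj, -⟩ := (hrule s hs).addBox_row (hmu s) (hlam _) (hi (by omega))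
        exact ⟨j, fun _ => hj⟩
      · exact ⟨0, fun h => absurd h hs⟩
  choose row hrow using hex
  have hstep : ∀ s, s + 2 ≤ k → row s ≤ row (s + 1) ∧ (row s = 0 → row (s + 1) = 2 →
      lam (s + 2) = mu s ∧ mu s 0 = mu s 1 ∧ mu s 1 = mu s 2) := by
    intro s hs
    obtain ⟨j, hj, hj'⟩ := (hrule s hs).addBox_row (hmu s) (hlam _) (hrow s (by omega))
    obtain rfl : j = row (s + 1) := addBox_eq_iff.1 (hj.symm.trans (hrow (s + 1) (by omega)))
    exact hj'
  have hmono : ∀ r s, r ≤ s → s < k → row r ≤ row s := by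
    intro r s hrs
    induction s, hrs using Nat.le_induction with
    | base => exact fun _ => le_rfl
    | succ s _ ih => exact fun hs => (ih (by omega)).trans (hstep s (by omega)).1
  have hrow0 : row 0 = 0 := addBox_eq_iff.1 ((hrow 0 hk).symm.trans hfirst)
  -- The last shape has three equal rows; removing a box from one of them leaves a generalized
  -- partition only for row `2`.
  have hrowk : row (k - 1) = 2 := by
    have h := hrow (k - 1) (by omega)
    rw [Nat.sub_add_cancel hk] at h
    have h0 := congrFun h 0
    have h2 := congrFun h 2
    have h1 := congrFun h 1
    have e := hmu (k - 1) (show (0 : Fin 3) ≤ 2 by decide)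
    have e' := hmu (k - 1) (show (1 : Fin 3) ≤ 2 by decide)
    have f := hlam k (show (0 : Fin 3) ≤ 1 by decide)
    by_contra hne
    have hlt : ∀ i : Fin 3, i ≠ 2 → i = 0 ∨ i = 1 := by decide
    obtain hi | hi := hlt _ hne <;> simp [addBox, hi] at h0 h1 h2 <;> omega
  have hm : ∃ s, row s ≠ 0 := ⟨k - 1, by rw [hrowk]; decide⟩
  have hn : ∃ s, row s = 2 := ⟨k - 1, hrowk⟩
  classical
  obtain ⟨m, hm1, hm2⟩ : ∃ m, row m ≠ 0 ∧ ∀ s < m, row s = 0 :=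
    ⟨Nat.find hm, Nat.find_spec hm, fun s hs => not_not.1 (Nat.find_min hm hs)⟩
  obtain ⟨n, hn1, hn2, hn3⟩ : ∃ n, row n = 2 ∧ (∀ s < n, row s ≠ 2) ∧ n ≤ k - 1 :=
    ⟨Nat.find hn, Nat.find_spec hn, fun s hs => Nat.find_min hn hs, Nat.find_min' hn hrowk⟩
  have hm0 : 1 ≤ m := by
    by_contra h
    exact hm1 (by rw [show m = 0 by omega, hrow0])
  -- If row `2` occurs as soon as row `0` is left, the sequence has jumped, which `hjump` forbids.
  have hmn : m < n := by
    by_contra h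
    have hmn : m = n := by
      by_contra hne
      have := hm2 n (by omega)
      rw [hn1] at this
      exact absurd this (by decide)
    subst hmn
    obtain ⟨q, rfl⟩ : ∃ q, m = q + 1 := ⟨m - 1, by omega⟩
    obtain ⟨h1, h2, h3⟩ := (hstep q (by omega)).2 (hm2 q (by omega)) hn1
    exact hjump q (by omega)
      (fun r hr => by rw [hrow r (by omega), hm2 r (by omega)]) h2 h3 h1
  -- `row s` belongs to the shape with index `s + 1`. Thus the first `s` with a nonzero row is the
  -- last index `m` of the top row, whereas the first `s` with row `2` must be shifted by one.
  refine ⟨m, n + 1, hm0, by omega, by omega, fun s hs => ⟨fun h => ?_, fun h h' => ?_, fun h => ?_⟩⟩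
  · rw [hrow s hs, hm2 s (by omega)]
  · have h1 := hmono m s (by omega) hs
    have h2 := hn2 s (by omega)
    rw [hrow s hs, show row s = 1 by
      revert h1 h2 hm1
      generalize row m = a
      generalize row s = b
      revert a b
      decide]
  · have h1 := hmono n s (by omega) hs
    rw [hn1] at h1
    rw [hrow s hs, show row s = 2 from le_antisymm (Fin.le_last _) h1]

/-! ### Exchanging adding and deleting of boxes -/

/-- The generalized partition `(-a_n, …, -a_1)`. -/
def flipShape {n : ℕ} (a : Fin n → ℤ) : Fin n → ℤ := fun i => -a i.rev

theorem flipShape_flipShape {n : ℕ} (a : Fin n → ℤ) : flipShape (flipShape a) = a := by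
  funext i
  simp [flipShape]

theorem flipShape_addBox {n : ℕ} (a : Fin n → ℤ) (i : Fin n) :
    flipShape (addBox a i) = delBox (flipShape a) i.rev := by
  funext j
  simp only [flipShape, addBox, delBox, Pi.add_apply, Pi.sub_apply, Pi.single_apply,
    Fin.rev_eq_iff]
  ring

theorem flipShape_delBox {n : ℕ} (a : Fin n → ℤ) (i : Fin n) :
    flipShape (delBox a i) = addBox (flipShape a) i.rev := by
  funext j
  simp only [flipShape, addBox, delBox, Pi.add_apply, Pi.sub_apply, Pi.single_apply,
    Fin.rev_eq_iff]
  ring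

theorem Antitone.flipShape {n : ℕ} {a : Fin n → ℤ} (h : Antitone a) : Antitone (flipShape a) :=
  fun _ _ hxy => neg_le_neg (h (Fin.rev_le_rev.2 hxy))

theorem antitone_flipShape {n : ℕ} {a : Fin n → ℤ} : Antitone (flipShape a) ↔ Antitone a :=
  ⟨fun h => flipShape_flipShape a ▸ h.flipShape, Antitone.flipShape⟩

/-- Negating and reversing swaps additions with deletions and row `i` with `i.rev`. The two halves
of the rule list are mirror images, including the search downwards in `op1d` and upwards in `op2d`.
-/
theorem GrowthRule.flipShape {n : ℕ} {mu lam lam' nu : Fin n → ℤ}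
    (h : GrowthRule mu lam lam' nu) :
    GrowthRule (flipShape mu) (flipShape lam) (flipShape lam') (flipShape nu) := by
  have hadd : ∀ i, Antitone (addBox (_root_.flipShape mu) i) ↔ Antitone (delBox mu i.rev) :=
    fun i => by rw [← antitone_flipShape, flipShape_addBox, flipShape_flipShape]
  have hdel : ∀ i, Antitone (delBox (_root_.flipShape mu) i) ↔ Antitone (addBox mu i.rev) :=
    fun i => by rw [← antitone_flipShape, flipShape_delBox, flipShape_flipShape]
  cases h with
  | op1a i j h1 h2 h =>
    subst h1 h2
    rw [flipShape_addBox mu j]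
    exact .op2a i.rev j.rev (flipShape_addBox _ _) (flipShape_addBox _ _) (by simpa [hdel] using h)
  | op1b i j h1 h2 hij h =>
    subst h1 h2
    rw [flipShape_addBox mu i]
    exact .op2b i.rev j.rev rfl (by rw [flipShape_addBox, flipShape_addBox])
      (by simpa using hij) (by simpa [hdel] using h)
  | op1c i j h1 h2 h =>
    subst h1 h2
    rw [flipShape_delBox mu j]
    exact .op2c i.rev j.rev (flipShape_addBox _ _) (flipShape_delBox _ _) (by simpa [hadd] using h)
  | op1d i r h1 h2 h hr hr' hmin =>
    subst h1 h2
    rw [flipShape_delBox mu r]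
    refine .op2d i.rev r.rev (flipShape_addBox _ _) (flipShape_delBox _ _) (by simpa [hadd] using h)
      (by simpa using hr) (by simpa [hadd] using hr') fun q hq hq' => ?_
    rw [hadd]
    exact hmin _ (Fin.lt_rev_iff.2 hq') (Fin.rev_lt_iff.2 hq)
  | op2a i j h1 h2 h =>
    subst h1 h2
    rw [flipShape_delBox mu j]
    exact .op1a i.rev j.rev (flipShape_delBox _ _) (flipShape_delBox _ _) (by simpa [hadd] using h)
  | op2b i j h1 h2 hij h =>
    subst h1 h2
    rw [flipShape_delBox mu i]
    exact .op1b i.rev j.rev rfl (by rw [flipShape_delBox, flipShape_delBox])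
      (by simpa using hij) (by simpa [hadd] using h)
  | op2c i j h1 h2 h =>
    subst h1 h2
    rw [flipShape_addBox mu j]
    exact .op1c i.rev j.rev (flipShape_delBox _ _) (flipShape_addBox _ _) (by simpa [hdel] using h)
  | op2d i r h1 h2 h hr hr' hmin =>
    subst h1 h2
    rw [flipShape_addBox mu r]
    refine .op1d i.rev r.rev (flipShape_delBox _ _) (flipShape_addBox _ _) (by simpa [hdel] using h)
      (by simpa using hr) (by simpa [hdel] using hr') fun q hq hq' => ?_
    rw [hdel]
    exact hmin _ (Fin.lt_rev_iff.2 hq') (Fin.rev_lt_iff.2 hq)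

/-! ### Closed dominant words and the web growth rules -/

/-- Letters of signature and state strings. -/
abbrev Letter := State × Color

/-- The weight of a letter. -/
def Letter.weight (a : Letter) : ℤ × ℤ := letterWeight a.1 a.2

/-- The letters of dominant weight. -/
def Letter.IsInitial (a : Letter) : Prop := a = (.one, .black) ∨ a = (.negOne, .white)

/-- The letters of antidominant weight. -/
def Letter.IsFinal (a : Letter) : Prop := a = (.one, .white) ∨ a = (.negOne, .black)

theorem Letter.isInitial_of_nonneg {a : Letter} (h : 0 ≤ a.weight) : a.IsInitial := by
  obtain ⟨s, c⟩ := a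
  cases s <;> cases c <;>
    simp_all [Letter.weight, letterWeight, State.weight, Letter.IsInitial, Prod.le_def]

theorem Letter.isFinal_of_nonpos {a : Letter} (h : a.weight ≤ 0) : a.IsFinal := by
  obtain ⟨s, c⟩ := a
  cases s <;> cases c <;>
    simp_all [Letter.weight, letterWeight, State.weight, Letter.IsFinal, Prod.le_def]

/-- The weight path of the word that starts at `p` stays in the dominant chamber and ends at the
origin. -/
def DominantFrom : ℤ × ℤ → List Letter → Prop
  | p, [] => p = 0
  | p, a :: l => 0 ≤ p ∧ DominantFrom (p + a.weight) l

theorem DominantFrom.nonneg {p : ℤ × ℤ} {l : List Letter} (h : DominantFrom p l) : 0 ≤ p := by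
  cases l with
  | nil => exact (show p = 0 from h).ge
  | cons a l => exact h.1

theorem DominantFrom.isInitial {a : Letter} {l : List Letter} (h : DominantFrom 0 (a :: l)) :
    a.IsInitial :=
  Letter.isInitial_of_nonneg (by simpa using h.2.nonneg)

/-- The partial sum before the last letter is dominant and equals minus the weight of that letter.
-/
theorem DominantFrom.isFinal {p : ℤ × ℤ} {l : List Letter} {a : Letter}
    (h : DominantFrom p (l ++ [a])) : a.IsFinal := by
  induction l generalizing p with
  | nil =>
    obtain ⟨h1, h2⟩ := h
    have h2 : p + a.weight = 0 := h2
    exact Letter.isFinal_of_nonpos (by rw [← h2]; exact le_add_of_nonneg_left h1)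
  | cons b l ih => exact ih h.2

theorem dominantFrom_of_path (l : List Letter) (path : ℕ → ℤ × ℤ)
    (hstep : ∀ i (hi : i < l.length), path (i + 1) = path i + l[i].weight)
    (hpos : ∀ i ≤ l.length, 0 ≤ path i) (hend : path l.length = 0) : DominantFrom (path 0) l := by
  induction l generalizing path with
  | nil => exact hend
  | cons a l ih =>
    refine ⟨hpos 0 (by simp), ?_⟩
    have h0 := hstep 0 (by simp)
    simp only [List.getElem_cons_zero, zero_add] at h0
    rw [← h0]
    exact ih (fun i => path (i + 1)) (fun i hi => hstep (i + 1) (by simpa using hi))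
      (fun i hi => hpos _ (by simpa using hi)) (by simpa using hend)

/-- Replacing neighbouring letters `a`, `b` by the word `m` respects dominance, `a` is not
antidominant and `b` is not dominant. -/
structure Replaceable (a b : Letter) (m : List Letter) : Prop where
  left : ¬ a.IsFinal
  right : ¬ b.IsInitial
  dominant : ∀ p r, DominantFrom p (a :: b :: r) → DominantFrom p (m ++ r)

theorem Replaceable.dominantFrom {a b : Letter} {m : List Letter} (h : Replaceable a b m)
    {p : ℤ × ℤ} {l r : List Letter} (hd : DominantFrom p (l ++ a :: b :: r)) :
    DominantFrom p (l ++ m ++ r) := by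
  induction l generalizing p with
  | nil => exact h.dominant p r hd
  | cons c l ih => exact ⟨hd.1, ih hd.2⟩

theorem Color.eq_of_ne_of_ne {a b c : Color} (hb : b ≠ a) (hc : c ≠ a) : b = c := by
  cases a <;> cases b <;> cases c <;> simp_all

/-! ### The three kinds of web growth rules as weight-preserving replacements -/

theorem YRule.replaceable {c c' : Color} {s₁ s₂ t : State} (h : YRule c s₁ s₂ t) (hc : c' ≠ c) :
    Replaceable (s₁, c) (s₂, c) [(t, c')] := by
  refine ⟨?_, ?_, fun p r hd => ?_⟩
  · cases h <;> simp [Letter.IsFinal]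
  · cases h <;> simp [Letter.IsInitial]
  · obtain ⟨h1, -, h3⟩ := hd
    refine ⟨h1, ?_⟩
    rw [add_assoc] at h3
    change DominantFrom (p + Letter.weight (t, c')) r
    convert h3 using 2
    cases h <;> cases c' <;> simp_all [Letter.weight, letterWeight, State.weight]

theorem HRule.replaceable {c c' : Color} {s₁ s₂ t₁ t₂ : State} (h : HRule c s₁ s₂ t₁ t₂)
    (hc : c' ≠ c) : Replaceable (s₁, c) (s₂, c') [(t₁, c'), (t₂, c)] := by
  refine ⟨?_, ?_, fun p r hd => ?_⟩
  · cases h <;> simp [Letter.IsFinal]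
  · cases h <;> cases c' <;> simp_all [Letter.IsInitial]
  · obtain ⟨h1, h2, h3⟩ := hd
    have h4 := h3.nonneg
    refine ⟨h1, ?_, ?_⟩
    -- Only the partial sum between the two new letters is new. It is dominant because the old sums
    -- before, between and after the two letters are.
    · obtain ⟨x, y⟩ := p
      cases h <;> cases c' <;>
        simp_all [Letter.weight, letterWeight, State.weight, Prod.le_def]
    · change DominantFrom (p + Letter.weight (t₁, c') + Letter.weight (t₂, c)) r
      rw [add_assoc] at h3 ⊢
      convert h3 using 2
      cases h <;> cases c' <;> simp_all [Letter.weight, letterWeight, State.weight]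

theorem ArcRule.replaceable {c c' : Color} {s : State} (h : ArcRule c s) (hc : c' ≠ c) :
    Replaceable (s, c) (s, c') [] := by
  refine ⟨?_, ?_, fun p r hd => ?_⟩
  · cases h <;> simp [Letter.IsFinal]
  · cases h <;> cases c' <;> simp_all [Letter.IsInitial]
  · obtain ⟨-, -, h3⟩ := hd
    rw [add_assoc] at h3
    change DominantFrom p r
    convert h3 using 1
    cases h <;> cases c' <;> simp_all [Letter.weight, letterWeight, State.weight]

/-- Where a replaceable pair sits in a word `x u y v` with `u`, `v` closed dominant and
`y` antidominant: it is the pair `x y`, or it lies in `u` or in `v`. -/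
theorem Replaceable.cases_of_eq {α : Type*} (f : α → Letter) {l r u v : List α} {a b x y : α}
    {m : List Letter} (h : Replaceable (f a) (f b) m) (hy : (f y).IsFinal)
    (hu : DominantFrom 0 (u.map f)) (hv : DominantFrom 0 (v.map f))
    (e : l ++ a :: b :: r = x :: u ++ y :: v) :
    (l = [] ∧ a = x ∧ b = y ∧ u = [] ∧ r = v) ∨
      (∃ l' r', l = x :: l' ∧ u = l' ++ a :: b :: r' ∧ r = r' ++ y :: v) ∨
      (∃ l', l = x :: u ++ y :: l' ∧ v = l' ++ a :: b :: r) := by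
  cases l with
  | nil =>
    cases u with
    | nil =>
      simp at e
      exact .inl ⟨rfl, e.1, e.2.1, rfl, e.2.2⟩
    -- Here `b` would be the first letter of the closed dominant word `u`, hence dominant.
    | cons c u =>
      simp at e
      exact absurd (e.2.1 ▸ DominantFrom.isInitial hu) h.right
  | cons c l =>
    simp only [List.cons_append, List.cons.injEq] at e
    obtain ⟨rfl, e⟩ := e
    rw [List.append_eq_append_iff] at e
    obtain ⟨w, rfl, hw⟩ | ⟨w, rfl, hw⟩ := e
    · cases w with
      | nil =>
        simp at hw
        exact absurd (hw.1 ▸ hy) h.left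
      | cons d w =>
        cases w with
        -- Here `a` would be the last letter of `u`, hence antidominant.
        | nil =>
          simp at hw
          obtain ⟨rfl, -⟩ := hw
          rw [List.map_append] at hu
          exact absurd hu.isFinal h.left
        | cons d' w =>
          simp at hw
          obtain ⟨rfl, rfl, rfl⟩ := hw
          exact .inr (.inl ⟨l, w, rfl, rfl, rfl⟩)
    · cases w with
      | nil =>
        simp at hw
        exact absurd (hw.1 ▸ hy) h.left
      | cons d w =>
        simp at hw
        obtain ⟨rfl, rfl⟩ := hw
        exact .inr (.inr ⟨w, by simp, rfl⟩)

/-- This is the invariant for the induction over the growth of a web: unless the step consumes `x`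
and `y` together, it rewrites a closed dominant word into another one and leaves both in place. -/
theorem Replaceable.eq_or_exists {α : Type*} (f : α → Letter) {l r u v m : List α} {a b x y : α}
    (h : Replaceable (f a) (f b) (m.map f)) (hy : (f y).IsFinal)
    (hu : DominantFrom 0 (u.map f)) (hv : DominantFrom 0 (v.map f))
    (e : l ++ a :: b :: r = x :: u ++ y :: v) :
    (a = x ∧ b = y) ∨ ∃ u' v', DominantFrom 0 (u'.map f) ∧ DominantFrom 0 (v'.map f) ∧
      l ++ m ++ r = x :: u' ++ y :: v' := by
  obtain ⟨-, ha, hb, -⟩ | ⟨l', r', rfl, rfl, rfl⟩ | ⟨l', rfl, rfl⟩ := h.cases_of_eq f hy hu hv e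
  · exact .inl ⟨ha, hb⟩
  · refine .inr ⟨l' ++ m ++ r', v, ?_, hv, by simp⟩
    simp only [List.map_append, List.map_cons] at hu ⊢
    exact h.dominantFrom hu
  · refine .inr ⟨u, l' ++ m ++ r, hu, ?_, by simp⟩
    simp only [List.map_append, List.map_cons] at hv ⊢
    exact h.dominantFrom hv

/-- The letter of a labelled strand. -/
def Web.letter {k : ℕ} {V : Type*} [Finite V] (D : Web k V) (x : Dart k V × State) : Letter :=
  (x.2, D.color x.1.vertex)

/-- The growth rules join two strands with opposite letters `x`, `y` of dominant and antidominant
weight if closed dominant words `u`, `v` stand between them and after them. -/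
theorem Web.Grows.edge_eq {k : ℕ} {V : Type*} [Finite V] {D : Web k V}
    {L : List (Dart k V × State)} {U : Set V} (h : D.Grows L U) {x y : Dart k V × State}
    (hx : (D.letter x).IsInitial) (hy : (D.letter y).IsFinal) (hxy : x.2 = y.2)
    {u v : List (Dart k V × State)} (hu : DominantFrom 0 (u.map D.letter))
    (hv : DominantFrom 0 (v.map D.letter)) (e : L = x :: u ++ y :: v) : D.edge x.1 = y.1 := by
  induction h generalizing u v with
  | done => simp at e
  | fork l r U d₁ d₂ s₁ s₂ t w a hc hrule h₁ h₂ hw h ih =>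
    -- The colour of a strand is that of its upper end, and bipartiteness determines it for the new
    -- strand.
    have hb : D.color (Sum.inr w) ≠ D.color d₁.vertex := by
      have := D.bipartite d₁
      rwa [h₁] at this
    have hrep : Replaceable (D.letter (d₁, s₁)) (D.letter (d₂, s₂))
        (List.map D.letter [((Sum.inr (w, a + 2) : Dart k V), t)]) := by
      simp only [Web.letter, hc]
      exact hrule.replaceable hb
    obtain ⟨rfl, rfl⟩ | ⟨u', v', hu', hv', e'⟩ := hrep.eq_or_exists D.letter hy hu hv e
    -- No Y rule joins two equal states.
    · simp only at hxy
      subst hxy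
      generalize D.color d₁.vertex = col at hrule
      cases hrule
    · exact ih hu' hv' (by simpa using e')
  | cross l r U d₁ d₂ s₁ s₂ t₁ t₂ w z a b hc hrule h₁ h₂ hmid hwz hw hz h ih =>
    have hb : D.color (Sum.inr w) = D.color d₂.vertex := by
      have := D.bipartite d₁
      rw [h₁] at this
      exact Color.eq_of_ne_of_ne this hc
    have hb' : D.color (Sum.inr z) = D.color d₁.vertex := by
      have := D.bipartite d₂
      rw [h₂] at this
      exact Color.eq_of_ne_of_ne this hc.symm
    have hrep : Replaceable (D.letter (d₁, s₁)) (D.letter (d₂, s₂)) (List.map D.letter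
        [((Sum.inr (w, a + 2) : Dart k V), t₁), ((Sum.inr (z, b + 1) : Dart k V), t₂)]) := by
      simp only [Web.letter, List.map_cons, List.map_nil, Dart.vertex, hb, hb']
      exact hrule.replaceable hc
    obtain ⟨rfl, rfl⟩ | ⟨u', v', hu', hv', e'⟩ := hrep.eq_or_exists D.letter hy hu hv e
    -- An H rule with equal states has both equal to `0`, but a dominant letter has state `1` or
    -- `-1`.
    · simp only at hxy
      subst hxy
      revert hx
      generalize hcol : D.color d₁.vertex = col at hrule
      cases hrule <;> simp [Letter.IsInitial, Web.letter]
    · exact ih hu' hv' (by simpa using e')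
  | arc l r U d₁ d₂ s hc hrule h₁ h ih =>
    have hrep : Replaceable (D.letter (d₁, s)) (D.letter (d₂, s)) (List.map D.letter []) :=
      hrule.replaceable hc
    obtain ⟨rfl, rfl⟩ | ⟨u', v', hu', hv', e'⟩ := hrep.eq_or_exists D.letter hy hu hv e
    · exact h₁
    · exact ih hu' hv' (by simpa using e')

/-! ### Weights of shapes -/

/-- The `sl(3)`-weight of a generalized partition with three parts. -/
def shapeWeight (a : Fin 3 → ℤ) : ℤ × ℤ := (a 0 - a 1, a 1 - a 2)

theorem shapeWeight_nonneg {a : Fin 3 → ℤ} (h : Antitone a) : 0 ≤ shapeWeight a :=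
  ⟨sub_nonneg.2 (h (by decide)), sub_nonneg.2 (h (by decide))⟩

theorem shapeWeight_letterAct (s : State) (c : Color) (a : Fin 3 → ℤ) :
    shapeWeight (letterAct s c a) = shapeWeight a + letterWeight s c := by
  cases s <;> cases c <;>
    simp [shapeWeight, letterAct, letterWeight, State.row, State.weight, addBox, delBox] <;>
    ring_nf <;> simp

theorem letterAct_eq_addBox {s : State} {c : Color} {a : Fin 3 → ℤ} {i : Fin 3}
    (h : letterAct s c a = addBox a i) : c = .black ∧ s.row = i := by
  cases c with
  | black => exact ⟨rfl, addBox_eq_iff.1 h⟩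
  | white => exact absurd h.symm (addBox_ne_delBox _ _ _)

theorem letterAct_eq_delBox {s : State} {c : Color} {a : Fin 3 → ℤ} {i : Fin 3}
    (h : letterAct s c a = delBox a i) : c = .white ∧ s.row = i := by
  cases c with
  | black => exact absurd h (addBox_ne_delBox _ _ _)
  | white => exact ⟨rfl, delBox_eq_iff.1 h⟩

theorem State.row_injective : Function.Injective State.row := by
  intro s t h
  cases s <;> cases t <;> simp_all [State.row]

/-- The shapes of a tableau as a sequence indexed by the natural numbers. -/
def GOT.seq {k n : ℕ} (T : GOT k n) (s : ℕ) : Fin n → ℤ := T.shape ⟨min s k, by omega⟩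

theorem GOT.seq_eq {k n : ℕ} (T : GOT k n) {s : ℕ} (h : s < k + 1) : T.seq s = T.shape ⟨s, h⟩ := by
  simp only [GOT.seq, min_eq_left (Nat.lt_succ_iff.1 h)]

theorem GOT.antitone_seq {k n : ℕ} (T : GOT k n) (s : ℕ) : Antitone (T.seq s) :=
  T.isGenPartition _

theorem GOT.seq_one_eq {k n : ℕ} (T : GOT k n) (hk : 1 ≤ k) : T.seq 1 = T.shape 1 := by
  obtain ⟨k, rfl⟩ := Nat.exists_eq_add_of_le' hk
  rw [T.seq_eq (by omega)]
  congr

theorem GOT.isPromotion_promotion {k n : ℕ} (T : GOT k n) : IsPromotion T T.promotion :=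
  T.existsUnique_isPromotion.choose_spec.1

theorem GOT.growthRule_seq {k n : ℕ} (T : GOT k n) (s : ℕ) (hs : s + 2 ≤ k) :
    GrowthRule (T.promotion.seq s) (T.seq (s + 1)) (T.seq (s + 2)) (T.promotion.seq (s + 1)) := by
  rw [GOT.seq_eq _ (by omega), GOT.seq_eq _ (by omega), GOT.seq_eq _ (by omega),
    GOT.seq_eq _ (by omega)]
  exact T.isPromotion_promotion.rule s hs

/-- The weights of the shapes form the weight path of the string. Weights ignore full columns, so
the last shape need not be empty; its three rows are equal. -/
theorem shapeWeight_seq_last {k : ℕ} {T : GOT k 3} {s : Fin k → State} {c : Fin k → Color}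
    (hs : IsDominant s c)
    (hT : ∀ i : Fin k, T.shape i.succ = letterAct (s i) (c i) (T.shape i.castSucc)) :
    shapeWeight (T.seq k) = 0 := by
  obtain ⟨path, h0, hend, hstep, -⟩ := hs
  have key : ∀ i, path i = shapeWeight (T.shape i) := by
    intro i
    induction i using Fin.induction with
    | zero => simp [h0, T.shape_zero, shapeWeight, Prod.ext_iff]
    | succ i ih => rw [hstep, ih, hT, shapeWeight_letterAct]
  rw [T.seq_eq (by omega), ← hend, key]
  rfl

/-- If the first letter of the string of a web and a later letter are opposite, and the
weight path returns to the origin with that later letter without leaving the dominant chamber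
translated by the first letter, then the web has an edge between two boundary vertices. -/
theorem Web.containsIdentity_of_path {k : ℕ} {V : Type*} [Finite V] {D : Web k V} {T : GOT k 3}
    {st : Fin k → State} (hst : D.HasStates st)
    (hT : ∀ i : Fin k, T.shape i.succ =
      letterAct (st i) (D.color (Sum.inl i)) (T.shape i.castSucc))
    {j : ℕ} (hj : j < k) (hj0 : 0 < j) (hstate : st ⟨0, by omega⟩ = st ⟨j, hj⟩)
    (hx : Letter.IsInitial (st ⟨0, by omega⟩, D.color (Sum.inl ⟨0, by omega⟩)))
    (hy : Letter.IsFinal (st ⟨j, hj⟩, D.color (Sum.inl ⟨j, hj⟩)))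
    (hpath : ∀ r < j, 0 ≤ shapeWeight (T.seq (r + 1)) - shapeWeight (T.seq 1))
    (hreturn : shapeWeight (T.seq j) = shapeWeight (T.seq 1))
    (hzero : shapeWeight (T.seq (j + 1)) = 0) : D.ContainsIdentity := by
  set L : List (Dart k V × State) := List.ofFn fun i => (Sum.inl i, st i) with hL
  have hlen : L.length = k := by simp [hL]
  have hstep : ∀ i (hi : i < L.length),
      shapeWeight (T.seq (i + 1)) = shapeWeight (T.seq i) + (D.letter L[i]).weight := by
    intro i hi
    rw [hlen] at hi
    rw [T.seq_eq (by omega), T.seq_eq (by omega)]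
    have := hT ⟨i, hi⟩
    simp only [Fin.succ_mk, Fin.castSucc_mk] at this
    rw [this, shapeWeight_letterAct]
    simp [hL, Web.letter, Letter.weight, Dart.vertex]
  -- The word strictly between the two letters, with its path translated so that it starts at the
  -- origin.
  have hu : DominantFrom 0 (((L.drop 1).take (j - 1)).map D.letter) := by
    have := dominantFrom_of_path (((L.drop 1).take (j - 1)).map D.letter)
      (fun i => shapeWeight (T.seq (i + 1)) - shapeWeight (T.seq 1)) ?_ ?_ ?_
    · simpa using this
    · intro i hi
      have h := hstep (i + 1) (by simp at hi; omega)
      rw [h]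
      simp only [List.getElem_map, List.getElem_take, List.getElem_drop, add_comm 1 i]
      abel
    · intro i hi
      simp at hi
      exact hpath i (by omega)
    · have : (((L.drop 1).take (j - 1)).map D.letter).length + 1 = j := by simp; omega
      simp only [this, hreturn, sub_self]
  have hv : DominantFrom 0 ((L.drop (j + 1)).map D.letter) := by
    have := dominantFrom_of_path ((L.drop (j + 1)).map D.letter)
      (fun i => shapeWeight (T.seq (j + 1 + i))) ?_ ?_ ?_
    · simpa [hzero] using this
    · intro i hi
      have h := hstep (j + 1 + i) (by simp at hi; omega)
      simp only [← add_assoc, h, List.getElem_map, List.getElem_drop]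
    · exact fun i _ => shapeWeight_nonneg (T.antitone_seq _)
    · have : j + 1 + ((L.drop (j + 1)).map D.letter).length = k := by simp; omega
      simp only [this]
      exact shapeWeight_seq_last hst.1 hT
  have hdec : L = (Sum.inl ⟨0, by omega⟩, st ⟨0, by omega⟩) :: (L.drop 1).take (j - 1) ++
      (Sum.inl ⟨j, hj⟩, st ⟨j, hj⟩) :: L.drop (j + 1) := by
    have e1 : L = L[0] :: L.drop 1 := by
      rw [← List.drop_eq_getElem_cons (by omega)]
      rfl
    have e2 : L.drop j = L[j] :: L.drop (j + 1) := List.drop_eq_getElem_cons (by omega)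
    have e3 : L.drop 1 = (L.drop 1).take (j - 1) ++ L.drop j := by
      conv_lhs => rw [← List.take_append_drop (j - 1) (L.drop 1), List.drop_drop,
        show 1 + (j - 1) = j by omega]
    have e4 : L[0] = (Sum.inl ⟨0, by omega⟩, st ⟨0, by omega⟩) := by simp [hL]
    have e5 : L[j] = (Sum.inl ⟨j, hj⟩, st ⟨j, hj⟩) := by simp [hL]
    rw [← e4, ← e5, List.cons_append, ← e2, ← e3, ← e1]
  exact ⟨_, _, hst.2.edge_eq (x := (Sum.inl ⟨0, by omega⟩, st ⟨0, by omega⟩))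
    (y := (Sum.inl ⟨j, hj⟩, st ⟨j, hj⟩)) hx hy hstate hu hv hdec⟩

/-! ### Excluding jumps and deducing the two cases -/

theorem flipShape_eq_addBox_iff {n : ℕ} {a b : Fin n → ℤ} {i : Fin n} :
    flipShape a = addBox (flipShape b) i ↔ a = delBox b i.rev := by
  rw [← (Function.LeftInverse.injective flipShape_flipShape).eq_iff, flipShape_flipShape,
    flipShape_addBox, flipShape_flipShape]

theorem addBox_delBox_self {n : ℕ} (a : Fin n → ℤ) (i : Fin n) : addBox (delBox a i) i = a := by
  rw [addBox_delBox, delBox_addBox_self]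

theorem GOT.seq_zero {k n : ℕ} (T : GOT k n) : T.seq 0 = 0 := by
  rw [T.seq_eq (by omega)]
  exact T.shape_zero

theorem GOT.one_le_of_shape_one_ne_zero {k n : ℕ} {T : GOT k n} (h : T.shape 1 ≠ 0) : 1 ≤ k := by
  by_contra hk
  obtain rfl : k = 0 := by omega
  exact h T.shape_zero

theorem shapeWeight_addBox_zero (a : Fin 3 → ℤ) :
    shapeWeight (addBox a 0) = shapeWeight a + (1, 0) :=
  shapeWeight_letterAct .one .black a

theorem shapeWeight_delBox_two (a : Fin 3 → ℤ) :
    shapeWeight (delBox a 2) = shapeWeight a + (0, 1) :=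
  shapeWeight_letterAct .negOne .white a

theorem mainTheorem5 {k : ℕ} {V : Type*} [Finite V] (D : Web k V) (hD : ¬ D.ContainsIdentity)
    (T : GOT k 3) (hT : T.ComesFrom D) :
    (T.shape 1 = ![1, 0, 0] →
      ∃ m n : ℕ, 1 ≤ m ∧ m + 1 < n ∧ n ≤ k ∧ ∀ s : Fin k,
        ((s : ℕ) + 1 ≤ m → T.shape s.succ = addBox (T.promotion.shape s.castSucc) 0) ∧
        (m < (s : ℕ) + 1 → (s : ℕ) + 1 < n →
          T.shape s.succ = addBox (T.promotion.shape s.castSucc) 1) ∧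
        (n ≤ (s : ℕ) + 1 → T.shape s.succ = addBox (T.promotion.shape s.castSucc) 2)) ∧
    (T.shape 1 = ![0, 0, -1] →
      ∃ m n : ℕ, 1 ≤ m ∧ m + 1 < n ∧ n ≤ k ∧ ∀ s : Fin k,
        ((s : ℕ) + 1 ≤ m → T.shape s.succ = delBox (T.promotion.shape s.castSucc) 2) ∧
        (m < (s : ℕ) + 1 → (s : ℕ) + 1 < n →
          T.shape s.succ = delBox (T.promotion.shape s.castSucc) 1) ∧
        (n ≤ (s : ℕ) + 1 → T.shape s.succ = delBox (T.promotion.shape s.castSucc) 0)) := by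
  obtain ⟨st, hst, hact⟩ := hT
  have hlast := shapeWeight_seq_last hst.1 hact
  have hlast' : T.seq k 0 = T.seq k 2 := by
    have h1 := congrArg Prod.fst hlast
    have h2 := congrArg Prod.snd hlast
    simp only [shapeWeight, Prod.fst_zero, Prod.snd_zero] at h1 h2
    omega
  have hseq : ∀ i (hi : i < k), letterAct (st ⟨i, hi⟩) (D.color (Sum.inl ⟨i, hi⟩)) (T.seq i) =
      T.seq (i + 1) := by
    intro i hi
    rw [T.seq_eq (by omega), T.seq_eq (by omega)]
    exact (hact ⟨i, hi⟩).symm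
  have hsucc : ∀ s : Fin k, T.shape s.succ = T.seq (s + 1) := fun s => (T.seq_eq (by omega)).symm
  have hcast : ∀ s : Fin k, T.promotion.shape s.castSucc = T.promotion.seq s :=
    fun s => (T.promotion.seq_eq (by omega)).symm
  simp only [hsucc, hcast]
  constructor
  · intro h1
    have hk : 1 ≤ k := GOT.one_le_of_shape_one_ne_zero (T := T) fun h => by
      simpa using congrFun (h1.symm.trans h) 0
    have hfirst : T.seq 1 = addBox 0 0 := by
      rw [T.seq_one_eq hk, h1]
      funext i
      fin_cases i <;> simp [addBox]
    obtain ⟨m, n, hm, hmn, hn, hall⟩ := exists_rows_of_growthRule hk T.antitone_seq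
      T.promotion.antitone_seq T.growthRule_seq (by rw [hfirst, GOT.seq_zero]) hlast' (by
        -- Suppose there is a jump at `q`. The letter at index `0` adds a box in row `0` and the
        -- letter at index `q + 1` deletes one there, so they are `(1,•)` and `(1,∘)`.
        intro q hq hpre e1 e2 e3
        obtain ⟨c0, r0⟩ := letterAct_eq_addBox (i := 0) ((hseq 0 hk).trans (by
          rw [hfirst, T.seq_zero]))
        obtain ⟨cq, rq⟩ := letterAct_eq_delBox (i := 0) ((hseq (q + 1) hq).trans (by
          rw [hpre q le_rfl, delBox_addBox_self, e3]))
        have s0 := State.row_injective (a₂ := .one) r0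
        have sq := State.row_injective (a₂ := .one) rq
        have hw1 : shapeWeight (T.seq 1) = (1, 0) := by simp [hfirst, shapeWeight, addBox]
        have hwq : shapeWeight (T.promotion.seq q) = 0 := by simp [shapeWeight, e1, e2]
        refine hD (Web.containsIdentity_of_path hst hact (j := q + 1) hq (by omega)
          (s0.trans sq.symm) (.inl (by rw [s0, c0])) (.inl (by rw [sq, cq])) ?_ ?_ ?_)
        -- Relative to `λ^1`, the weight of `λ^{r+1}` is exactly that of `μ^r`, a generalized
        -- partition.
        · intro r hr
          rw [hpre r (by omega), hw1, shapeWeight_addBox_zero, add_sub_cancel_right]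
          exact shapeWeight_nonneg (T.promotion.antitone_seq r)
        · rw [hpre q le_rfl, shapeWeight_addBox_zero, hw1, hwq, zero_add]
        · rw [e3, hwq])
    exact ⟨m, n, hm, hmn, hn, fun s => hall s s.2⟩
  · intro h1
    have hk : 1 ≤ k := GOT.one_le_of_shape_one_ne_zero (T := T) fun h => by
      simpa using congrFun (h1.symm.trans h) 2
    have hfirst : T.seq 1 = delBox 0 2 := by
      rw [T.seq_one_eq hk, h1]
      funext i
      fin_cases i <;> simp [delBox]
    -- The flipped sequences satisfy the hypotheses of the first case; a jump is translated back to
    -- the original shapes, where the opposite letters are `(-1,∘)` and `(-1,•)`.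
    obtain ⟨m, n, hm, hmn, hn, hall⟩ := exists_rows_of_growthRule hk
      (lam := fun s => flipShape (T.seq s)) (mu := fun s => flipShape (T.promotion.seq s))
      (fun s => (T.antitone_seq s).flipShape) (fun s => (T.promotion.antitone_seq s).flipShape)
      (fun s hs => (T.growthRule_seq s hs).flipShape)
      (flipShape_eq_addBox_iff.2 (by rw [hfirst, GOT.seq_zero]; rfl))
      (congrArg Neg.neg hlast'.symm) (by
        simp only [flipShape_eq_addBox_iff]
        intro q hq hpre e1 e2 e3
        -- Reversal turns row `0` into row `2` by definition, so the flipped facts can be restated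
        -- for the original shapes.
        replace hpre : ∀ r ≤ q, T.seq (r + 1) = delBox (T.promotion.seq r) 2 := hpre
        replace e1 : T.promotion.seq q 2 = T.promotion.seq q 1 := neg_injective e1
        replace e2 : T.promotion.seq q 1 = T.promotion.seq q 0 := neg_injective e2
        replace e3 := Function.LeftInverse.injective flipShape_flipShape e3
        obtain ⟨c0, r0⟩ := letterAct_eq_delBox (i := 2) ((hseq 0 hk).trans (by
          rw [hfirst, T.seq_zero]))
        obtain ⟨cq, rq⟩ := letterAct_eq_addBox (i := 2) ((hseq (q + 1) hq).trans (by
          rw [hpre q le_rfl, addBox_delBox_self, e3]))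
        have s0 := State.row_injective (a₂ := .negOne) r0
        have sq := State.row_injective (a₂ := .negOne) rq
        have hw1 : shapeWeight (T.seq 1) = (0, 1) := by simp [hfirst, shapeWeight, delBox]
        have hwq : shapeWeight (T.promotion.seq q) = 0 := by simp [shapeWeight, e1, e2]
        refine hD (Web.containsIdentity_of_path hst hact (j := q + 1) hq (by omega)
          (s0.trans sq.symm) (.inr (by rw [s0, c0])) (.inr (by rw [sq, cq])) ?_ ?_ ?_)
        · intro r hr
          rw [hpre r (by omega), hw1, shapeWeight_delBox_two, add_sub_cancel_right]
          exact shapeWeight_nonneg (T.promotion.antitone_seq r)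
        · rw [hpre q le_rfl, shapeWeight_delBox_two, hw1, hwq, zero_add]
        · rw [e3, hwq])
    simp only [flipShape_eq_addBox_iff] at hall
    exact ⟨m, n, hm, hmn, hn, fun s => hall s s.2⟩
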